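/- Let $(X,\tau)$ be a $\sigma$-order complete Hausdorff locally convex-solid (that is, locally convex and locally solid) vector lattice which is a Fréchet space, i.e. $\tau$ is metrizable and $X$ is complete. Let $X'$ be the topological dual of $X$, and let $|\sigma|(X,X')$ be the absolute weak topology, generated by the seminorms $x\mapsto f(|x|)$, $0\le f\in X'$. Say that $X$ has - the disjoint Banach–Saks property (LSDBSP) if every $\tau$-bounded sequence $(x_n)$ of pairwise disjoint elements of $X$ has a subsequence $(x_{n_k})$ whose Cesàro means $\frac1n\sum_{k=1}^n x_{n_k}$ are $\tau$-convergent; - the unbounded Banach–Saks property (LSUBSP) if every $\tau$-bounded sequence $(x_n)$ in $X$ such that, for each $u\in X_+$, $|x_n|\wedge u\to 0$ with respect to $|\sigma|(X,X')$, has a subsequence whose Cesàro means are $\tau$-convergent. Say that $X$ contains a lattice copy of $\ell_\infty$ if there is a linear lattice homomorphism $\ell_\infty\to X$ which is a homeomorphism onto its range. Then: (a) if $X$ has the LSDBSP, then $X$ has the LSUBSP if and only if $X$ contains no lattice copy of $\ell_\infty$; (b) if $X$ contains a lattice copy of $\ell_\infty$, then $X$ does not have the LSUBSP (whether or not it has the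 LSDBSP). -/

import Mathlib

open Filter Topology
open scoped BoundedContinuousFunction

/-- A topology on a vector lattice is locally solid if the solid neighbourhoods of zero form a
basis of neighbourhoods of zero. -/
class IsLocallySolid (X : Type*) [AddCommGroup X] [Lattice X] [TopologicalSpace X] : Prop where
  hasBasis_nhds_zero : (𝓝 (0 : X)).HasBasis
    (fun s : Set X => s ∈ 𝓝 (0 : X) ∧ LatticeOrderedAddCommGroup.IsSolid s) id

/-- `σ`-order completeness: every nonempty countable subset that is bounded above has a
supremum. -/
def IsSigmaOrderComplete (X : Type*) [Lattice X] : Prop :=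
  ∀ s : Set X, s.Nonempty → s.Countable → BddAbove s → ∃ a, IsLUB s a

theorem abs_real_smul_of_vectorLattice {X : Type*} [AddCommGroup X] [Lattice X]
    [IsOrderedAddMonoid X] [Module ℝ X] [IsOrderedModule ℝ X] (c : ℝ) (x : X) :
    |c • x| = |c| • |x| := by
  have key : ∀ (d : ℝ) (y : X), 0 < d → |d • y| = d • |y| := by
    intro d y hd
    have h : d • (y ⊔ -y) = d • y ⊔ d • (-y) := (OrderIso.smulRight (β := X) hd).map_sup y (-y)
    rw [smul_neg] at h
    exact h.symm
  rcases lt_trichotomy c 0 with h | h | h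
  · rw [abs_of_neg h, ← key (-c) x (neg_pos.2 h), neg_smul, abs_neg]
  · simp [h]
  · rw [abs_of_pos h, key c x h]

section AbsoluteWeak

variable (X : Type*) [AddCommGroup X] [Lattice X] [IsOrderedAddMonoid X] [Module ℝ X]
  [IsOrderedModule ℝ X] [TopologicalSpace X]

/-- The positive elements of the topological dual `X'`. -/
def PositiveDual : Type _ := {f : X →L[ℝ] ℝ // ∀ x : X, 0 ≤ x → 0 ≤ f x}

instance : Nonempty (PositiveDual X) := ⟨⟨0, fun _ _ => le_rfl⟩⟩

/-- The seminorms `x ↦ f |x|`, where `f` runs over the positive continuous linear functionals.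
In a locally solid vector lattice, `X'` is an ideal of the order dual, so this family consists of
the same seminorms as the family `x ↦ |f| |x|` with `f` in `X'`. -/
noncomputable def absoluteWeakSeminorms : SeminormFamily ℝ X (PositiveDual X) := fun f =>
  Seminorm.of (fun x => f.1 |x|)
    (fun x y => by
      have h : 0 ≤ f.1 (|x| + |y| - |x + y|) := f.2 _ (sub_nonneg.2 (abs_add_le x y))
      rw [map_sub, map_add] at h
      linarith)
    (fun c x => by
      rw [abs_real_smul_of_vectorLattice, map_smul, smul_eq_mul, Real.norm_eq_abs])

/-- The absolute weak topology `|σ|(X, X')`: the linear topology generated by the seminorms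
`x ↦ f |x|`. -/
@[reducible]
noncomputable def absoluteWeakTopology : TopologicalSpace X :=
  (absoluteWeakSeminorms X).moduleFilterBasis.topology

end AbsoluteWeak

/-- The sequence `x` converges to zero in the unbounded sense with respect to the topology `t`:
for each `u ≥ 0`, `|x n| ⊓ u` converges to zero for `t`. -/
def IsUnboundedNull {X : Type*} [AddCommGroup X] [Lattice X] (t : TopologicalSpace X)
    (x : ℕ → X) : Prop :=
  ∀ u : X, 0 ≤ u → Tendsto (fun n => |x n| ⊓ u) atTop (@nhds X t 0)

/-- Some subsequence of `x` has convergent Cesàro means. -/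
def HasCesaroConvergentSubseq {X : Type*} [AddCommGroup X] [Module ℝ X] [TopologicalSpace X]
    (x : ℕ → X) : Prop :=
  ∃ φ : ℕ → ℕ, StrictMono φ ∧ ∃ a : X,
    Tendsto (fun n : ℕ => (n : ℝ)⁻¹ • ∑ k ∈ Finset.range n, x (φ k)) atTop (𝓝 a)

/-- The unbounded Banach–Saks property: every bounded sequence which is null for the
unbounded absolute weak convergence has a subsequence with convergent Cesàro means. -/
def LSUBSP (X : Type*) [AddCommGroup X] [Lattice X] [IsOrderedAddMonoid X] [Module ℝ X]
    [IsOrderedModule ℝ X] [TopologicalSpace X] : Prop :=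
  ∀ x : ℕ → X, Bornology.IsVonNBounded ℝ (Set.range x) →
    IsUnboundedNull (absoluteWeakTopology X) x → HasCesaroConvergentSubseq x

/-- The disjoint Banach–Saks property: every bounded sequence of pairwise disjoint elements has a
subsequence with convergent Cesàro means. -/
def LSDBSP (X : Type*) [AddCommGroup X] [Lattice X] [Module ℝ X] [TopologicalSpace X] : Prop :=
  ∀ x : ℕ → X, Bornology.IsVonNBounded ℝ (Set.range x) →
    (∀ i j : ℕ, i ≠ j → |x i| ⊓ |x j| = 0) → HasCesaroConvergentSubseq x

/-- `X` contains a lattice copy of `ℓ∞`: there is a linear lattice homomorphism from `ℓ∞` to `X`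
that is a homeomorphism onto its range. Here `ℓ∞` is the space of bounded real sequences (every
function on `ℕ` is continuous) with the supremum norm and the pointwise order. -/
def ContainsLatticeCopyOfLInfty (X : Type*) [AddCommGroup X] [Lattice X] [Module ℝ X]
    [TopologicalSpace X] : Prop :=
  ∃ T : (ℕ →ᵇ ℝ) →ₗ[ℝ] X,
    (∀ a b, T (a ⊔ b) = T a ⊔ T b) ∧ (∀ a b, T (a ⊓ b) = T a ⊓ T b) ∧ IsEmbedding T

/-! A copy of `ℓ∞` destroys the LSUBSP through a Schreier-type sequence. Index the coordinates by
finite sets `A ⊆ ℕ`, call `A` admissible if `|A| ≤ min A`, and let `e_n` be the indicator of "`A` is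
admissible and `n ∈ A`". The overlaps of a fixed `e_n` with all `e_k` add up to at most `n • 1`, so
positive functionals tend to zero along `e_n`. Every subsequence nevertheless has non-Cauchy Cesàro
means, because a block of its indices is an admissible set. A lattice embedding carries all this
into `X`.

Conversely, suppose that there is no copy of `ℓ∞`. An order bounded disjoint sequence `d` that is
not null would give one, since `σ`-order completeness provides the suprema of `a_n⁺ • d_n`. Hence
such sequences are null (`IsPreLebesgue`). It follows that order bounded monotone sequences
converge, and that order bounded positive sequences annihilated in the limit by every positive
functional are null (`IsPreLebesgue.tendsto_of_forall_positiveDual`). For an unbounded null sequence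
`x` this gives `|x i| ⊓ |x k| → 0` in the original topology for each `i`. A Kadec–Pełczyński
argument (`exists_disjoint_approx`) then extracts a subsequence that differs from a bounded disjoint
one by a null sequence, and the LSDBSP applies. -/

set_option linter.unusedSectionVars false

/-! ### Inequalities in vector lattices -/

section LatticeGroup

variable {X : Type*} [AddCommGroup X] [Lattice X] [IsOrderedAddMonoid X]

/-- Riesz decomposition, with `z₁` equal to `z` clamped to `[-a, a]`. It yields the triangle
inequality for `solidSeminorm`. -/
theorem exists_add_eq_of_abs_le_add {z a b : X} (ha : 0 ≤ a) (hb : 0 ≤ b) (hz : |z| ≤ a + b) :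
    ∃ z₁ z₂, z = z₁ + z₂ ∧ |z₁| ≤ a ∧ |z₂| ≤ b := by
  obtain ⟨h1, h2⟩ := abs_le'.1 hz
  refine ⟨(z ⊓ a) ⊔ (-a), z - ((z ⊓ a) ⊔ (-a)), by abel, abs_le'.2 ⟨?_, ?_⟩, abs_le'.2 ⟨?_, ?_⟩⟩
  · exact sup_le inf_le_right (neg_le_self ha)
  · rw [neg_le]; exact le_sup_right
  · rw [sub_le_comm]
    refine le_sup_of_le_left (le_inf (sub_le_self z hb) ?_)
    rwa [sub_le_iff_le_add]
  · rw [neg_sub, sub_le_iff_le_add]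
    refine sup_le (inf_le_left.trans (le_add_of_nonneg_left hb)) ?_
    rw [neg_le_iff_add_nonneg]
    have := add_le_add_right h2 z
    simp only [add_neg_cancel] at this
    calc (0 : X) ≤ z + (a + b) := this
      _ = _ := by abel

theorem sub_posPart_sub_mem {a v : X} (ha : 0 ≤ a) (hv : 0 ≤ v) :
    0 ≤ a - (a - v)⁺ ∧ a - (a - v)⁺ ≤ v := by
  refine ⟨sub_nonneg.2 (sup_le (sub_le_self a hv) ha), ?_⟩
  rw [sub_le_comm]
  exact le_posPart _

/-- The truncation of `x` obtained by removing the part of absolute value at most `v`. -/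
def softThreshold (x v : X) : X := (x⁺ - v)⁺ - (x⁻ - v)⁺

theorem abs_softThreshold_le (x v : X) : |softThreshold x v| ≤ (|x| - v)⁺ := by
  have h1 : x⁺ ≤ |x| := sup_le (le_abs_self x) (abs_nonneg x)
  have h2 : x⁻ ≤ |x| := sup_le (neg_le_abs x) (abs_nonneg x)
  refine abs_le'.2 ⟨?_, ?_⟩
  · exact (sub_le_self _ (posPart_nonneg _)).trans (posPart_mono (sub_le_sub_right h1 v))
  · rw [softThreshold, neg_sub]
    exact (sub_le_self _ (posPart_nonneg _)).trans (posPart_mono (sub_le_sub_right h2 v))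

theorem abs_sub_softThreshold_le (x : X) {v : X} (hv : 0 ≤ v) : |x - softThreshold x v| ≤ v := by
  obtain ⟨h1, h2⟩ := sub_posPart_sub_mem (posPart_nonneg x) hv
  obtain ⟨h3, h4⟩ := sub_posPart_sub_mem (negPart_nonneg x) hv
  have e : x - softThreshold x v = (x⁺ - (x⁺ - v)⁺) - (x⁻ - (x⁻ - v)⁺) := by
    rw [softThreshold, sub_sub_sub_comm x⁺, posPart_sub_negPart]
  rw [e]
  refine abs_le'.2 ⟨(sub_le_self _ h3).trans h2, ?_⟩
  rw [neg_sub]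
  exact (sub_le_self _ h1).trans h4

/-- The remainders `a - a ⊓ b` and `b - a ⊓ b` are disjoint, and removing more keeps them so. This
is the source of the disjoint sequences below. -/
theorem posPart_sub_inf_posPart_sub {a b c d : X} (hc : a ⊓ b ≤ c) (hd : a ⊓ b ≤ d) :
    (a - c)⁺ ⊓ (b - d)⁺ = 0 := by
  refine le_antisymm ?_ (le_inf (posPart_nonneg _) (posPart_nonneg _))
  have h1 : (a - c)⁺ ≤ a - a ⊓ b :=
    sup_le (sub_le_sub_left hc a) (sub_nonneg.2 inf_le_left)
  have h2 : (b - d)⁺ ≤ b - a ⊓ b :=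
    sup_le (sub_le_sub_left hd b) (sub_nonneg.2 inf_le_right)
  calc (a - c)⁺ ⊓ (b - d)⁺ ≤ (a - a ⊓ b) ⊓ (b - a ⊓ b) := inf_le_inf h1 h2
    _ = 0 := by rw [← inf_sub, sub_self]

theorem add_eq_sup_of_inf_eq_zero {a b : X} (h : a ⊓ b = 0) : a + b = a ⊔ b := by
  rw [← inf_add_sup a b, h, zero_add]

theorem posPart_sub_of_inf_eq_zero {a b : X} (h : a ⊓ b = 0) : (a - b)⁺ = a := by
  have := inf_eq_sub_posPart_sub a b
  rw [h, eq_comm, sub_eq_zero] at this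
  exact this.symm

theorem inf_add_le {a b c : X} (ha : 0 ≤ a) (hb : 0 ≤ b) (hc : 0 ≤ c) :
    (a + b) ⊓ c ≤ a ⊓ c + b ⊓ c := by
  rw [inf_add, add_inf, add_inf]
  refine le_inf (le_inf inf_le_left ?_) (le_inf ?_ ?_)
  · exact inf_le_right.trans (le_add_of_nonneg_left ha)
  · exact inf_le_right.trans (le_add_of_nonneg_right hb)
  · exact inf_le_right.trans (le_add_of_nonneg_right hc)

theorem exists_lowerBound_posPart {ι : Type*} (a : ι → X) (s : Finset ι) (hs : s.Nonempty) :
    ∃ m, (∀ i ∈ s, m ≤ a i) ∧ ∀ z, (∀ i ∈ s, z ≤ (a i)⁺) → z ≤ m⁺ := by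
  classical
  induction hs using Finset.Nonempty.cons_induction with
  | singleton i => exact ⟨a i, by simp, by simp⟩
  | cons i s hi hs ih =>
    obtain ⟨m, hm, hz⟩ := ih
    refine ⟨a i ⊓ m, ?_, fun z h => ?_⟩
    · intro j hj
      rcases Finset.mem_cons.1 hj with rfl | hj
      · exact inf_le_left
      · exact inf_le_right.trans (hm j hj)
    · let _ := AddCommGroup.toDistribLattice X
      have e : (a i ⊓ m)⁺ = (a i)⁺ ⊓ m⁺ := sup_inf_right (a i) m 0
      rw [e]
      exact le_inf (h i (Finset.mem_cons_self i s))
        (hz z fun j hj => h j (Finset.mem_cons_of_mem hj))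

/-- The infimum of the `a i` is at most their average, hence nonpositive, and by distributivity
taking positive parts commutes with finite infima. -/
theorem nonpos_of_forall_le_posPart [Module ℝ X] [IsOrderedModule ℝ X] {ι : Type*} {a : ι → X}
    {s : Finset ι} (hs : s.Nonempty) (ha : ∑ i ∈ s, a i ≤ 0) {z : X}
    (hz : ∀ i ∈ s, z ≤ (a i)⁺) : z ≤ 0 := by
  obtain ⟨m, hm, hmz⟩ := exists_lowerBound_posPart a s hs
  have h1 : (s.card : ℝ) • m ≤ 0 := by
    rw [Nat.cast_smul_eq_nsmul, ← Finset.sum_const]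
    exact (Finset.sum_le_sum hm).trans ha
  have hc : (s.card : ℝ) ≠ 0 := by exact_mod_cast hs.card_pos.ne'
  have h2 : m ≤ 0 := by
    have := smul_le_smul_of_nonneg_left h1 (inv_nonneg.2 (Nat.cast_nonneg (α := ℝ) s.card))
    rwa [smul_smul, inv_mul_cancel₀ hc, one_smul, smul_zero] at this
  exact (hmz z hz).trans (posPart_nonpos.2 h2)

end LatticeGroup

/-! ### Lattice seminorms generating the topology -/

section LatticeSeminorm

variable {X : Type*} [AddCommGroup X] [Lattice X] [IsOrderedAddMonoid X]
    [Module ℝ X] [IsOrderedModule ℝ X]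

/-- A solid neighbourhood inside the unit ball of `q` contains `t • x` for some `t > 0`, and with it
every `t • z`. -/
theorem exists_solid_hull_bound [TopologicalSpace X] [ContinuousSMul ℝ X] [IsLocallySolid X]
    {q : Seminorm ℝ X} (hq : Continuous q) (x : X) :
    BddAbove (Set.range fun z : {z : X // |z| ≤ |x|} => q z) := by
  obtain ⟨V, ⟨hV, hVs⟩, hVq⟩ := IsLocallySolid.hasBasis_nhds_zero.mem_iff.1
    (q.ball_mem_nhds hq one_pos)
  have h : Tendsto (fun t : ℝ => t • x) (𝓝[>] 0) (𝓝 0) := by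
    have : Tendsto (fun t : ℝ => t • x) (𝓝 0) (𝓝 ((0 : ℝ) • x)) :=
      (continuous_id.smul continuous_const).tendsto 0
    rw [zero_smul] at this
    exact this.mono_left nhdsWithin_le_nhds
  obtain ⟨t, ht, ht0⟩ := ((h.eventually hV).and self_mem_nhdsWithin).exists
  have ht0 : 0 < t := ht0
  refine ⟨t⁻¹, ?_⟩
  rintro _ ⟨⟨z, hz⟩, rfl⟩
  have h1 : t • z ∈ V := hVs ht (by
    rw [abs_real_smul_of_vectorLattice, abs_real_smul_of_vectorLattice]
    exact smul_le_smul_of_nonneg_left hz (abs_nonneg t))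
  have h2 := hVq h1
  simp only [Seminorm.mem_ball, sub_zero, map_smul_eq_mul, Real.norm_eq_abs,
    abs_of_pos ht0] at h2
  change q z ≤ t⁻¹
  rw [← one_div, le_div_iff₀ ht0, mul_comm]
  exact h2.le

/-- The least lattice seminorm dominating a continuous seminorm. -/
noncomputable def solidSeminorm [TopologicalSpace X] [ContinuousSMul ℝ X] [IsLocallySolid X]
    (q : Seminorm ℝ X) (hq : Continuous q) : Seminorm ℝ X :=
  Seminorm.ofSMulLE (fun x => ⨆ z : {z : X // |z| ≤ |x|}, q z)
    (by
      have : ∀ z : {z : X // |z| ≤ |(0 : X)|}, q z = 0 := fun ⟨z, hz⟩ => by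
        rw [abs_zero] at hz
        have hz0 : z = 0 := le_antisymm ((le_abs_self z).trans hz)
          (neg_nonpos.1 ((neg_le_abs z).trans hz))
        simp [hz0]
      simp [this])
    (fun x y => by
      have : Nonempty {z : X // |z| ≤ |x + y|} := ⟨⟨x + y, le_rfl⟩⟩
      refine ciSup_le fun ⟨z, hz⟩ => ?_
      obtain ⟨z₁, z₂, rfl, h1, h2⟩ := exists_add_eq_of_abs_le_add (abs_nonneg x) (abs_nonneg y)
        (hz.trans (abs_add_le x y))
      exact (map_add_le_add q z₁ z₂).trans (add_le_add
        (le_ciSup (exists_solid_hull_bound hq x) ⟨z₁, h1⟩)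
        (le_ciSup (exists_solid_hull_bound hq y) ⟨z₂, h2⟩)))
    (fun c x => by
      have : Nonempty {z : X // |z| ≤ |c • x|} := ⟨⟨c • x, le_rfl⟩⟩
      refine ciSup_le fun ⟨z, hz⟩ => ?_
      rw [abs_real_smul_of_vectorLattice] at hz
      rcases eq_or_ne c 0 with rfl | hc
      · rw [abs_zero, zero_smul] at hz
        have hz0 : z = 0 := le_antisymm ((le_abs_self z).trans hz)
          (neg_nonpos.1 ((neg_le_abs z).trans hz))
        simp [hz0]
      · have h1 : |c⁻¹ • z| ≤ |x| := by
          rw [abs_real_smul_of_vectorLattice]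
          have := smul_le_smul_of_nonneg_left hz (abs_nonneg c⁻¹)
          rwa [smul_smul, ← abs_mul, inv_mul_cancel₀ hc, abs_one, one_smul] at this
        have h2 : q z = ‖c‖ * q (c⁻¹ • z) := by
          rw [← map_smul_eq_mul, smul_smul, mul_inv_cancel₀ hc, one_smul]
        change q z ≤ _
        rw [h2]
        exact mul_le_mul_of_nonneg_left (le_ciSup (exists_solid_hull_bound hq x) ⟨_, h1⟩)
          (norm_nonneg c))

/-- An increasing sequence of continuous lattice seminorms which generates the topology. -/
structure IsLatticeSeminormBasis [TopologicalSpace X] (P : ℕ → Seminorm ℝ X) : Prop where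
  mono : ∀ ⦃m n⦄, m ≤ n → ∀ x, P m x ≤ P n x
  cont : ∀ n, Continuous (P n)
  solid : ∀ n ⦃x y⦄, |x| ≤ |y| → P n x ≤ P n y
  basis : ∀ U ∈ 𝓝 (0 : X), ∃ n, ∃ r > 0, ∀ x, P n x < r → x ∈ U

theorem exists_continuous_lattice_seminorm [TopologicalSpace X] [IsTopologicalAddGroup X]
    [ContinuousSMul ℝ X] [IsLocallySolid X] [LocallyConvexSpace ℝ X] {U : Set X}
    (hU : U ∈ 𝓝 (0 : X)) :
    ∃ p : Seminorm ℝ X, Continuous p ∧ (∀ ⦃x y⦄, |x| ≤ |y| → p x ≤ p y) ∧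
      ∃ r > 0, ∀ x, p x < r → x ∈ U := by
  obtain ⟨q, hq, r, hr, hqU⟩ : ∃ q : Seminorm ℝ X, Continuous q ∧ ∃ r > 0, q.ball 0 r ⊆ U := by
    have h := with_gaugeSeminormFamily (𝕜 := ℝ) (E := X)
    obtain ⟨⟨s, r⟩, hr, hs⟩ := h.hasBasis_zero_ball.mem_iff.1 hU
    refine ⟨_, ?_, r, hr, hs⟩
    exact Seminorm.continuous (r := r) (h.hasBasis_zero_ball.mem_of_mem (i := (s, r)) hr)
  obtain ⟨V, ⟨hV, hVs⟩, hVq⟩ := IsLocallySolid.hasBasis_nhds_zero.mem_iff.1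
    (q.ball_mem_nhds hq one_pos)
  have hle : ∀ x, q x ≤ solidSeminorm q hq x := fun x =>
    le_ciSup (exists_solid_hull_bound hq x) ⟨x, le_rfl⟩
  refine ⟨solidSeminorm q hq, ?_, fun x y hxy => ?_, r, hr, fun x hx => ?_⟩
  · refine Seminorm.continuous' (r := 1) (mem_of_superset hV fun x hx => ?_)
    rw [Seminorm.mem_closedBall, sub_zero]
    have : Nonempty {z : X // |z| ≤ |x|} := ⟨⟨x, le_rfl⟩⟩
    refine ciSup_le fun ⟨z, hz⟩ => ?_
    have := hVq (hVs hx hz)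
    simp only [Seminorm.mem_ball, sub_zero] at this
    exact this.le
  · have : Nonempty {z : X // |z| ≤ |x|} := ⟨⟨x, le_rfl⟩⟩
    exact ciSup_le fun ⟨z, hz⟩ =>
      le_ciSup (exists_solid_hull_bound hq y) ⟨z, hz.trans hxy⟩
  · apply hqU
    rw [Seminorm.mem_ball, sub_zero]
    exact (hle x).trans_lt hx

theorem exists_isLatticeSeminormBasis [TopologicalSpace X] [IsTopologicalAddGroup X]
    [ContinuousSMul ℝ X] [IsLocallySolid X] [LocallyConvexSpace ℝ X]
    [FirstCountableTopology X] : ∃ P : ℕ → Seminorm ℝ X, IsLatticeSeminormBasis P := by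
  obtain ⟨U, hU⟩ := (𝓝 (0 : X)).exists_antitone_basis
  choose p hpc hps r hr hp using fun n =>
    exists_continuous_lattice_seminorm (hU.1.mem_of_mem (i := n) trivial)
  have happ : ∀ n x, (∑ i ∈ Finset.range (n + 1), p i) x = ∑ i ∈ Finset.range (n + 1), p i x :=
    fun n x => by
      induction n with
      | zero => simp
      | succ n ih => rw [Finset.sum_range_succ, add_apply, ih,
          Finset.sum_range_succ _ (n + 1)]
  -- Partial sums make the family increasing and preserve continuity and solidity.
  refine ⟨fun n => ∑ i ∈ Finset.range (n + 1), p i, ⟨fun m n hmn x => ?_, fun n => ?_,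
    fun n x y hxy => ?_, fun V hV => ?_⟩⟩
  · rw [happ, happ]
    exact Finset.sum_le_sum_of_subset_of_nonneg (Finset.range_mono (by omega))
      fun i _ _ => apply_nonneg _ _
  · simp only [funext (happ n)]
    exact continuous_finsetSum _ fun i _ => hpc i
  · rw [happ, happ]
    exact Finset.sum_le_sum fun i _ => hps i hxy
  · obtain ⟨n, -, hn⟩ := hU.1.mem_iff.1 hV
    refine ⟨n, r n, hr n, fun x hx => hn (hp n x (lt_of_le_of_lt ?_ hx))⟩
    rw [happ]
    exact Finset.single_le_sum (f := fun i => p i x) (fun i _ => apply_nonneg _ _)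
      (Finset.self_mem_range_succ n)

namespace IsLatticeSeminormBasis

section Topological

variable [TopologicalSpace X] {P : ℕ → Seminorm ℝ X}

theorem apply_le (hP : IsLatticeSeminormBasis P) {x y : X} (n : ℕ) (hx : 0 ≤ x) (hxy : x ≤ y) : P n x ≤ P n y :=
  hP.solid n (by rwa [abs_of_nonneg hx, abs_of_nonneg (hx.trans hxy)])

theorem apply_abs (hP : IsLatticeSeminormBasis P) (n : ℕ) (x : X) : P n |x| = P n x :=
  le_antisymm (hP.solid n (abs_abs x).le) (hP.solid n (abs_abs x).ge)

theorem tendsto_zero_iff (hP : IsLatticeSeminormBasis P) {ι : Type*} {l : Filter ι} {x : ι → X} :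
    Tendsto x l (𝓝 0) ↔ ∀ n, Tendsto (fun k => P n (x k)) l (𝓝 0) := by
  refine ⟨fun h n => ?_, fun h => ?_⟩
  · have := ((hP.cont n).tendsto 0).comp h
    rwa [map_zero] at this
  · intro U hU
    obtain ⟨n, r, hr, hn⟩ := hP.basis U hU
    exact ((h n).eventually (gt_mem_nhds hr)).mono fun k hk => hn _ hk

theorem tendsto_zero_of_le (hP : IsLatticeSeminormBasis P) {ι : Type*} {l : Filter ι} {x y : ι → X} (hy : Tendsto y l (𝓝 0))
    (hxy : ∀ i, |x i| ≤ |y i|) : Tendsto x l (𝓝 0) :=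
  hP.tendsto_zero_iff.2 fun n => squeeze_zero (fun _ => apply_nonneg _ _)
    (fun i => hP.solid n (hxy i)) (hP.tendsto_zero_iff.1 hy n)

theorem eq_zero (hP : IsLatticeSeminormBasis P) [T1Space X] {x : X} (h : ∀ n, P n x = 0) : x = 0 := by
  by_contra hx
  obtain ⟨n, r, hr, hn⟩ := hP.basis {x}ᶜ (isOpen_compl_singleton.mem_nhds (Ne.symm hx))
  exact hn x (by rw [h n]; exact hr) rfl

theorem nonneg_of_tendsto (hP : IsLatticeSeminormBasis P) [IsTopologicalAddGroup X] [T1Space X] {ι : Type*} {l : Filter ι}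
    [l.NeBot] {s : ι → X} {a : X} (hs : Tendsto s l (𝓝 a)) (h0 : ∀ᶠ i in l, 0 ≤ s i) :
    0 ≤ a := by
  rw [← negPart_eq_zero]
  refine hP.eq_zero fun n => le_antisymm ?_ (apply_nonneg _ _)
  have h1 : Tendsto (fun i => s i - a) l (𝓝 0) := by simpa using hs.sub_const a
  refine ge_of_tendsto (hP.tendsto_zero_iff.1 h1 n) (h0.mono fun i hi => hP.solid n ?_)
  rw [abs_of_nonneg (negPart_nonneg a)]
  refine sup_le ((le_sub_iff_add_le.2 ?_).trans (le_abs_self _)) (abs_nonneg _)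
  rwa [neg_add_cancel]

theorem le_of_tendsto' (hP : IsLatticeSeminormBasis P) [IsTopologicalAddGroup X] [T1Space X] {ι : Type*} {l : Filter ι}
    [l.NeBot] {s : ι → X} {a b : X} (hs : Tendsto s l (𝓝 a)) (h : ∀ᶠ i in l, s i ≤ b) : a ≤ b :=
  sub_nonneg.1 (hP.nonneg_of_tendsto (hs.const_sub b) (h.mono fun _ hi => sub_nonneg.2 hi))

theorem ge_of_tendsto' (hP : IsLatticeSeminormBasis P) [IsTopologicalAddGroup X] [T1Space X] {ι : Type*} {l : Filter ι}
    [l.NeBot] {s : ι → X} {a b : X} (hs : Tendsto s l (𝓝 a)) (h : ∀ᶠ i in l, b ≤ s i) : b ≤ a :=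
  sub_nonneg.1 (hP.nonneg_of_tendsto (hs.sub_const b) (h.mono fun _ hi => sub_nonneg.2 hi))

theorem apply_tendsto (hP : IsLatticeSeminormBasis P) {ι : Type*} {l : Filter ι} {s : ι → X} {a : X} (hs : Tendsto s l (𝓝 a))
    (n : ℕ) : Tendsto (fun i => P n (s i)) l (𝓝 (P n a)) :=
  ((hP.cont n).tendsto a).comp hs

end Topological

theorem cauchySeq [UniformSpace X] [IsUniformAddGroup X] {P : ℕ → Seminorm ℝ X}
    (hP : IsLatticeSeminormBasis P) {s : ℕ → X}
    (h : ∀ n, ∀ ε > 0, ∃ N, ∀ m ≥ N, P n (s m - s N) < ε) : CauchySeq s := by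
  rw [(𝓝 (0 : X)).basis_sets.uniformity_of_nhds_zero.cauchySeq_iff']
  intro U hU
  obtain ⟨n, r, hr, hn⟩ := hP.basis U hU
  obtain ⟨N, hN⟩ := h n r hr
  refine ⟨N, fun m hm => hn _ ?_⟩
  change P n (s N - s m) < r
  rw [map_sub_rev]
  exact hN m hm

end IsLatticeSeminormBasis

end LatticeSeminorm

/-! ### Approximation by disjoint sequences -/

/-- The recursion builds pairs (level, index). Strictly increasing levels are at least `k` at stage
`k`, and `hanti` then lowers the level to `k`. -/
theorem exists_strictMono_forall_lt {Q : ℕ → ℕ → ℕ → Prop}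
    (h : ∀ n i, ∀ᶠ k in atTop, Q n i k) (hanti : ∀ m n i k, m ≤ n → Q n i k → Q m i k) :
    ∃ φ : ℕ → ℕ, StrictMono φ ∧ ∀ i k, i < k → Q k (φ i) (φ k) := by
  obtain ⟨f, -, hf⟩ := exists_seq_of_forall_finset_exists (α := ℕ × ℕ) (fun _ => True)
    (fun a b => a.1 < b.1 ∧ a.2 < b.2 ∧ Q b.1 a.2 b.2) (fun s _ => by
      have h1 : ∀ᶠ k in atTop, ∀ a ∈ s, a.2 < k ∧ Q (s.sup Prod.fst + 1) a.2 k :=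
        (Finset.eventually_all s).2 fun a _ => (eventually_gt_atTop a.2).and (h _ _)
      obtain ⟨k, hk⟩ := h1.exists
      exact ⟨(s.sup Prod.fst + 1, k), trivial, fun a ha =>
        ⟨Nat.lt_succ_of_le (Finset.le_sup (f := Prod.fst) ha), hk a ha⟩⟩)
  have hpos : StrictMono fun k => (f k).1 := fun i k hik => (hf i k hik).1
  exact ⟨fun k => (f k).2, fun i k hik => (hf i k hik).2.1, fun i k hik =>
    hanti _ _ _ _ (hpos.id_le k) (hf i k hik).2.2⟩

section

variable {X : Type*} [AddCommGroup X] [Lattice X] [IsOrderedAddMonoid X]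
    [Module ℝ X] [IsOrderedModule ℝ X]

theorem Seminorm.apply_sum_le {E ι : Type*} [AddCommGroup E] [Module ℝ E] (p : Seminorm ℝ E)
    (s : Finset ι) (f : ι → E) : p (∑ i ∈ s, f i) ≤ ∑ i ∈ s, p (f i) :=
  Finset.le_sum_of_subadditive p (map_zero p).le (map_add_le_add p) s f

/-- A sequence whose members are asymptotically disjoint from each fixed member has a subsequence
which is a null perturbation of a disjoint sequence. -/
theorem IsLatticeSeminormBasis.exists_disjoint_approx [UniformSpace X] [IsUniformAddGroup X]
    [CompleteSpace X] [T1Space X] {P : ℕ → Seminorm ℝ X} (hP : IsLatticeSeminormBasis P)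
    {x : ℕ → X} (hx : ∀ i, Tendsto (fun k => |x i| ⊓ |x k|) atTop (𝓝 0)) :
    ∃ φ : ℕ → ℕ, StrictMono φ ∧ ∃ d : ℕ → X, (∀ i j, i ≠ j → |d i| ⊓ |d j| = 0) ∧
      (∀ k, |d k| ≤ |x (φ k)|) ∧ Tendsto (fun k => x (φ k) - d k) atTop (𝓝 0) := by
  obtain ⟨φ, hφ, hQ⟩ := exists_strictMono_forall_lt
    (Q := fun n i k => P n (|x i| ⊓ |x k|) ≤ (1 / 4 : ℝ) ^ n)
    (fun n i => (hP.tendsto_zero_iff.1 (hx i) n).eventually_le_const (by positivity))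
    (fun m n i k hmn h => (hP.mono hmn _).trans (h.trans
      (pow_le_pow_of_le_one (by norm_num) (by norm_num) hmn)))
  -- Since `2 * max i k ≥ i + k`, the rate `1/4` splits into a product that is summable in `i` and
  -- small in `k`.
  have hmax : ∀ i k : ℕ, (1 / 4 : ℝ) ^ max i k ≤ (1 / 2) ^ i * (1 / 2) ^ k := fun i k => by
    rw [← pow_add, show (1 / 4 : ℝ) = (1 / 2) ^ 2 by norm_num, ← pow_mul]
    exact pow_le_pow_of_le_one (by norm_num) (by norm_num) (by omega)
  set c : ℕ → ℕ → X := fun i k => if i = k then 0 else |x (φ i)| ⊓ |x (φ k)| with hc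
  have hc0 : ∀ i k, 0 ≤ c i k := fun i k => by
    simp only [hc]
    split_ifs
    · exact le_rfl
    · exact le_inf (abs_nonneg _) (abs_nonneg _)
  have hcb : ∀ n i k, n ≤ max i k → P n (c i k) ≤ (1 / 2) ^ i * (1 / 2) ^ k := fun n i k hn => by
    refine le_trans ?_ (hmax i k)
    simp only [hc]
    split_ifs with h
    · rw [map_zero]; positivity
    · refine (hP.mono hn _).trans ?_
      rcases lt_or_gt_of_ne h with h | h
      · rw [max_eq_right h.le]; exact hQ i k h
      · rw [max_eq_left h.le, inf_comm]; exact hQ k i h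
  -- The sum `v k` of all overlaps with the `k`-th term dominates each of them and still tends to
  -- zero.
  have hlim : ∀ k, ∃ v, Tendsto (fun m => ∑ i ∈ Finset.range m, c i k) atTop (𝓝 v) := fun k => by
    refine cauchySeq_tendsto_of_complete (hP.cauchySeq fun n ε hε => ?_)
    obtain ⟨N, hN⟩ := exists_pow_lt_of_lt_one (show 0 < ε / 2 by positivity)
      (show (1 / 2 : ℝ) < 1 by norm_num)
    refine ⟨max N n, fun m hm => ?_⟩
    rw [← Finset.sum_Ico_eq_sub _ hm]
    calc P n (∑ i ∈ Finset.Ico (max N n) m, c i k)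
        ≤ ∑ i ∈ Finset.Ico (max N n) m, P n (c i k) := Seminorm.apply_sum_le _ _ _
      _ ≤ ∑ i ∈ Finset.Ico (max N n) m, (1 / 2 : ℝ) ^ i := by
          refine Finset.sum_le_sum fun i hi => (hcb n i k ?_).trans ?_
          · have := (Finset.mem_Ico.1 hi).1
            omega
          · exact mul_le_of_le_one_right (by positivity)
              (pow_le_one₀ (by norm_num) (by norm_num))
      _ ≤ (1 / 2 : ℝ) ^ max N n / (1 - 1 / 2) :=
          geom_sum_Ico_le_of_lt_one (by norm_num) (by norm_num)
      _ ≤ (1 / 2 : ℝ) ^ N / (1 - 1 / 2) := by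
          gcongr ?_ / _
          exact pow_le_pow_of_le_one (by norm_num) (by norm_num) (le_max_left _ _)
      _ < ε := by
          rw [div_lt_iff₀ (by norm_num)]
          linarith
  choose v hv using hlim
  have hv0 : ∀ k, 0 ≤ v k := fun k =>
    hP.nonneg_of_tendsto (hv k) (Eventually.of_forall fun m => Finset.sum_nonneg fun i _ => hc0 i k)
  have hcv : ∀ i k, c i k ≤ v k := fun i k =>
    hP.ge_of_tendsto' (hv k) ((eventually_gt_atTop i).mono fun m hm =>
      Finset.single_le_sum (f := fun i => c i k) (fun j _ => hc0 j k) (Finset.mem_range.2 hm))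
  have hvb : ∀ n k, n ≤ k → P n (v k) ≤ 2 * (1 / 2) ^ k := fun n k hnk => by
    refine le_of_tendsto (hP.apply_tendsto (hv k) n) (Eventually.of_forall fun m => ?_)
    calc P n (∑ i ∈ Finset.range m, c i k)
        ≤ ∑ i ∈ Finset.range m, P n (c i k) := Seminorm.apply_sum_le _ _ _
      _ ≤ ∑ i ∈ Finset.range m, (1 / 2 : ℝ) ^ i * (1 / 2) ^ k :=
          Finset.sum_le_sum fun i _ => hcb n i k (hnk.trans (le_max_right _ _))
      _ = (∑ i ∈ Finset.range m, (1 / 2 : ℝ) ^ i) * (1 / 2) ^ k := by rw [Finset.sum_mul]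
      _ ≤ 2 * (1 / 2) ^ k := by
          gcongr
          exact sum_geometric_two_le m
  have hv_lim : Tendsto v atTop (𝓝 0) := hP.tendsto_zero_iff.2 fun n => by
    have h0 : Tendsto (fun k : ℕ => 2 * (1 / 2 : ℝ) ^ k) atTop (𝓝 (2 * 0)) :=
      (tendsto_pow_atTop_nhds_zero_of_lt_one (by norm_num) (by norm_num)).const_mul 2
    rw [mul_zero] at h0
    exact squeeze_zero' (Eventually.of_forall fun k => apply_nonneg _ _)
      ((eventually_ge_atTop n).mono fun k hk => hvb n k hk) h0
  -- Truncation at `v k` removes every overlap and moves the term by at most `v k`.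
  refine ⟨φ, hφ, fun k => softThreshold (x (φ k)) (v k), fun i j hij => ?_, fun k => ?_, ?_⟩
  · have h1 := hcv j i
    have h2 := hcv i j
    simp only [hc, if_neg hij, if_neg hij.symm] at h1 h2
    refine le_antisymm ?_ (le_inf (abs_nonneg _) (abs_nonneg _))
    rw [← posPart_sub_inf_posPart_sub (inf_comm (|x (φ i)|) _ ▸ h1) h2]
    exact inf_le_inf (abs_softThreshold_le _ _) (abs_softThreshold_le _ _)
  · exact (abs_softThreshold_le _ _).trans (sup_le (sub_le_self _ (hv0 k)) (abs_nonneg _))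
  · exact hP.tendsto_zero_of_le hv_lim fun k =>
      (abs_sub_softThreshold_le _ (hv0 k)).trans (le_abs_self _)

end

/-! ### Lattice homomorphisms from `ℓ∞` built on disjoint sequences -/

section DisjointSup

variable {X : Type*} [AddCommGroup X] [Lattice X] [IsOrderedAddMonoid X]
    [Module ℝ X] [IsOrderedModule ℝ X]

/-- For `m ≠ n` disjointness gives `u m + v n = u m ⊔ v n ≤ s`, so `s` bounds the mixed sums as well
as the diagonal ones. -/
theorem isLUB_add_of_disjoint {u v : ℕ → X} {a b s : X} (hu : ∀ n, 0 ≤ u n) (hv : ∀ n, 0 ≤ v n)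
    (huv : ∀ m n, m ≠ n → u m ⊓ v n = 0) (ha : IsLUB (Set.range u) a)
    (hb : IsLUB (Set.range v) b) (hs : IsLUB (Set.range fun n => u n + v n) s) : s = a + b := by
  have hs' : ∀ n, u n + v n ≤ s := fun n => hs.1 ⟨n, rfl⟩
  refine le_antisymm (hs.2 ?_) ?_
  · rintro _ ⟨n, rfl⟩
    exact add_le_add (ha.1 ⟨n, rfl⟩) (hb.1 ⟨n, rfl⟩)
  · rw [← le_sub_iff_add_le]
    refine ha.2 ?_
    rintro _ ⟨m, rfl⟩
    rw [le_sub_comm]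
    refine hb.2 ?_
    rintro _ ⟨n, rfl⟩
    rw [le_sub_iff_add_le]
    rcases eq_or_ne m n with rfl | h
    · rw [add_comm]; exact hs' m
    · rw [add_comm, add_eq_sup_of_inf_eq_zero (huv m n h)]
      exact sup_le ((le_add_of_nonneg_right (hv m)).trans (hs' m))
        ((le_add_of_nonneg_left (hu n)).trans (hs' n))

/-- Each `u n` is disjoint from `c ⊓ a`, so their sum is at most their supremum. Thus `a - c ⊓ a` is
still an upper bound. -/
theorem inf_isLUB_eq_zero {u : ℕ → X} {a c : X} (hc : 0 ≤ c) (ha0 : 0 ≤ a)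
    (hu : ∀ n, c ⊓ u n = 0) (ha : IsLUB (Set.range u) a) : c ⊓ a = 0 := by
  refine le_antisymm ?_ (le_inf hc ha0)
  have h : a ≤ a - c ⊓ a := by
    refine ha.2 ?_
    rintro _ ⟨n, rfl⟩
    have hn : u n ≤ a := ha.1 ⟨n, rfl⟩
    rw [le_sub_iff_add_le]
    have : u n + c ⊓ a ≤ u n ⊔ (c ⊓ a) := by
      rw [← inf_add_sup]
      refine add_le_of_nonpos_left ?_
      rw [← hu n, inf_comm]
      exact inf_le_inf_right _ inf_le_left
    exact this.trans (sup_le hn inf_le_right)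
  simpa using h

theorem smul_inf_smul_eq_zero {a b : X} (ha : 0 ≤ a) (hb : 0 ≤ b) (h : a ⊓ b = 0) {s t : ℝ}
    (hs : 0 ≤ s) (ht : 0 ≤ t) : (s • a) ⊓ (t • b) = 0 := by
  refine le_antisymm ?_ (le_inf (smul_nonneg hs ha) (smul_nonneg ht hb))
  -- The summand `1` makes the common factor strictly positive, so that scaling by it is an order
  -- isomorphism.
  set r := s ⊔ t + 1
  have hr : 0 < r := by have : s ≤ s ⊔ t := le_sup_left; positivity
  have e : (r • a) ⊓ (r • b) = 0 := by
    have := (OrderIso.smulRight (β := X) hr).map_inf a b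
    rw [h] at this
    simpa using this.symm
  rw [← e]
  refine inf_le_inf (smul_le_smul_of_nonneg_right ?_ ha) (smul_le_smul_of_nonneg_right ?_ hb)
  · have : s ≤ s ⊔ t := le_sup_left
    simp only [r]; linarith
  · have : t ≤ s ⊔ t := le_sup_right
    simp only [r]; linarith

/-- An order bounded sequence of pairwise disjoint positive elements of a `σ`-order complete
vector lattice yields a lattice homomorphism on `ℓ∞`. -/
theorem exists_lattice_hom_of_disjoint (hX : IsSigmaOrderComplete X) {d : ℕ → X} {u : X}
    (hd0 : ∀ n, 0 ≤ d n) (hdu : ∀ n, d n ≤ u) (hd : ∀ m n, m ≠ n → d m ⊓ d n = 0) :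
    ∃ T : (ℕ →ᵇ ℝ) →ₗ[ℝ] X,
      (∀ a b, T (a ⊔ b) = T a ⊔ T b) ∧ (∀ a b, T (a ⊓ b) = T a ⊓ T b) ∧
      (∀ a, |T a| ≤ ‖a‖ • u) ∧ ∀ a n, |a n| • d n ≤ |T a| := by
  -- `S a` is the supremum of `a_n⁺ • d_n`. The homomorphism is `S a - S (-a)`, and these two terms
  -- turn out to be its positive and negative parts.
  have hex : ∀ a : ℕ →ᵇ ℝ, ∃ s, IsLUB (Set.range fun n => (a n ⊔ 0) • d n) s := fun a => by
    refine hX _ (Set.range_nonempty _) (Set.countable_range _) ⟨‖a‖ • u, ?_⟩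
    rintro _ ⟨n, rfl⟩
    exact (smul_le_smul_of_nonneg_right
      (sup_le ((le_abs_self _).trans (a.norm_coe_le_norm n)) (norm_nonneg a)) (hd0 n)).trans
      (smul_le_smul_of_nonneg_left (hdu n) (norm_nonneg a))
  choose S hS using hex
  have hSle : ∀ a n, (a n ⊔ 0) • d n ≤ S a := fun a n => (hS a).1 ⟨n, rfl⟩
  have hS0 : ∀ a, 0 ≤ S a := fun a =>
    (smul_nonneg le_sup_right (hd0 0)).trans (hSle a 0)
  have hSb : ∀ a, S a ≤ ‖a‖ • u := fun a => (hS a).2 (by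
    rintro _ ⟨n, rfl⟩
    exact (smul_le_smul_of_nonneg_right
      (sup_le ((le_abs_self _).trans (a.norm_coe_le_norm n)) (norm_nonneg a)) (hd0 n)).trans
      (smul_le_smul_of_nonneg_left (hdu n) (norm_nonneg a)))
  have hSadd : ∀ a b : ℕ →ᵇ ℝ, 0 ≤ a → 0 ≤ b → S (a + b) = S a + S b := fun a b ha hb => by
    refine isLUB_add_of_disjoint (fun n => smul_nonneg le_sup_right (hd0 n))
      (fun n => smul_nonneg le_sup_right (hd0 n))
      (fun m n hmn => smul_inf_smul_eq_zero (hd0 m) (hd0 n) (hd m n hmn) le_sup_right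
        le_sup_right) (hS a) (hS b) ?_
    convert hS (a + b) using 3 with n
    have h1 : 0 ≤ a n := ha n
    have h2 : 0 ≤ b n := hb n
    rw [← add_smul, BoundedContinuousFunction.add_apply, sup_eq_left.2 h1, sup_eq_left.2 h2,
      sup_eq_left.2 (add_nonneg h1 h2)]
  have hSsmul : ∀ (c : ℝ) (a : ℕ →ᵇ ℝ), 0 < c → S (c • a) = c • S a := fun c a hc => by
    have h1 : IsLUB (Set.range fun n => ((c • a) n ⊔ 0) • d n) (c • S a) := by
      have h2 := (OrderIso.smulRight (β := X) hc).isLUB_image'.2 (hS a)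
      rw [← Set.range_comp] at h2
      change IsLUB _ (c • S a) at h2
      convert h2 using 3 with n
      simp only [Function.comp, OrderIso.smulRight_apply, smul_smul,
        BoundedContinuousFunction.coe_smul, smul_eq_mul]
      rw [mul_max_of_nonneg _ _ hc.le, mul_zero]
    exact (hS _).unique h1
  have hSdisj : ∀ a : ℕ →ᵇ ℝ, S a ⊓ S (-a) = 0 := fun a => by
    refine inf_isLUB_eq_zero (hS0 _) (hS0 _) (fun n => ?_) (hS (-a))
    rw [inf_comm]
    refine inf_isLUB_eq_zero (smul_nonneg le_sup_right (hd0 n)) (hS0 _) (fun m => ?_) (hS a)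
    rcases eq_or_ne n m with rfl | h
    · rw [BoundedContinuousFunction.coe_neg, Pi.neg_apply]
      rcases le_total 0 (a n) with h | h
      · rw [sup_eq_right.2 (neg_nonpos.2 h), zero_smul]
        exact inf_eq_left.2 (smul_nonneg le_sup_right (hd0 n))
      · rw [sup_eq_right.2 h, zero_smul]
        exact inf_eq_right.2 (smul_nonneg le_sup_right (hd0 n))
    · exact smul_inf_smul_eq_zero (hd0 n) (hd0 m) (hd n m h) le_sup_right le_sup_right
  have hSpos : ∀ a : ℕ →ᵇ ℝ, S (a ⊔ 0) = S a := fun a => by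
    refine (hS _).unique ?_
    convert hS a using 3 with n
    rw [BoundedContinuousFunction.coe_sup, Pi.sup_apply]
    simp
  -- `S` is additive only on the positive cone, so `(a+b)⁺ + a⁻ + b⁻ = (a+b)⁻ + a⁺ + b⁺` is used,
  -- where all terms are positive.
  have hSsub : ∀ a b : ℕ →ᵇ ℝ, S (a + b) + S (-a) + S (-b) = S (-(a + b)) + S a + S b :=
    fun a b => by
      have h0 : ∀ a : ℕ →ᵇ ℝ, (0 : ℕ →ᵇ ℝ) ≤ a ⊔ 0 := fun a => le_sup_right
      rw [← hSpos (a + b), ← hSpos (-a), ← hSpos (-b), ← hSpos (-(a + b)), ← hSpos a, ← hSpos b,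
        ← hSadd _ _ (h0 _) (h0 _), ← hSadd _ _ (add_nonneg (h0 _) (h0 _)) (h0 _),
        ← hSadd _ _ (h0 _) (h0 _), ← hSadd _ _ (add_nonneg (h0 _) (h0 _)) (h0 _)]
      congr 1
      ext n
      simp only [BoundedContinuousFunction.add_apply, BoundedContinuousFunction.coe_sup,
        Pi.sup_apply, BoundedContinuousFunction.coe_neg, Pi.neg_apply,
        BoundedContinuousFunction.coe_zero, Pi.zero_apply, BoundedContinuousFunction.coe_add,
        Pi.add_apply]
      have h1 : ∀ t : ℝ, t ⊔ 0 = t + (-t) ⊔ 0 := fun t => by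
        rcases le_total 0 t with h | h
        · rw [sup_eq_left.2 h, sup_eq_right.2 (neg_nonpos.2 h), add_zero]
        · rw [sup_eq_right.2 h, sup_eq_left.2 (neg_nonneg.2 h), add_neg_cancel]
      rw [h1 (a n + b n), h1 (a n), h1 (b n)]
      ring
  let T : (ℕ →ᵇ ℝ) →ₗ[ℝ] X :=
    { toFun := fun a => S a - S (-a)
      map_add' := fun a b => by
        rw [sub_add_sub_comm, sub_eq_sub_iff_add_eq_add, ← add_assoc, hSsub]
        abel
      map_smul' := fun c a => by
        rw [RingHom.id_apply]
        rcases lt_trichotomy c 0 with h | rfl | h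
        · have h' := neg_pos.2 h
          rw [← neg_smul, hSsmul _ _ h', show c • a = -c • -a by simp, hSsmul _ _ h', neg_smul,
            neg_smul, smul_sub]
          abel
        · simp
        · rw [← smul_neg, hSsmul _ _ h, hSsmul _ _ h, smul_sub] }
  have hT : ∀ a, T a = S a - S (-a) := fun a => rfl
  have hTpos : ∀ a, (T a)⁺ = S a := fun a => posPart_sub_of_inf_eq_zero (hSdisj a)
  have hTneg : ∀ a, (T a)⁻ = S (-a) := fun a => by
    rw [← posPart_neg, ← map_neg, hTpos]
  have hTabs : ∀ a, |T a| = S a + S (-a) := fun a => by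
    rw [← posPart_add_negPart, hTpos, hTneg]
  have hTsup0 : ∀ a, T (a ⊔ 0) = (T a)⁺ := fun a => by
    have h1 : S (-(a ⊔ 0)) = 0 := by
      refine (hS _).unique ?_
      have : ∀ n, ((-(a ⊔ 0)) n ⊔ 0) • d n = 0 := fun n => by
        rw [BoundedContinuousFunction.coe_neg, Pi.neg_apply, BoundedContinuousFunction.coe_sup,
          Pi.sup_apply, BoundedContinuousFunction.coe_zero, Pi.zero_apply,
          sup_eq_right.2 (neg_nonpos.2 le_sup_right), zero_smul]
      simp only [this, Set.range_const]
      exact isLUB_singleton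
    rw [hTpos, hT, hSpos, h1, sub_zero]
  have hsup : ∀ a b, T (a ⊔ b) = T a ⊔ T b := fun a b => by
    have e : a ⊔ b = b + (a - b) ⊔ 0 := by
      rw [add_sup, add_sub_cancel, add_zero]
    rw [e, map_add, hTsup0, map_sub, sup_eq_add_posPart_sub]
  refine ⟨T, hsup, fun a b => ?_, fun a => ?_, fun a n => ?_⟩
  · have e := congrArg T (inf_add_sup a b)
    rw [map_add, map_add, hsup, ← inf_add_sup (T a) (T b)] at e
    exact add_right_cancel e
  · refine abs_le'.2 ⟨(sub_le_self _ (hS0 _)).trans (hSb a), ?_⟩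
    rw [hT, neg_sub, ← norm_neg a]
    exact (sub_le_self _ (hS0 _)).trans (hSb (-a))
  · rw [hTabs]
    rcases le_total 0 (a n) with h | h
    · rw [abs_of_nonneg h]
      refine le_add_of_le_of_nonneg ?_ (hS0 _)
      have := hSle a n
      rwa [sup_eq_left.2 h] at this
    · rw [abs_of_nonpos h]
      refine le_add_of_nonneg_of_le (hS0 _) ?_
      have := hSle (-a) n
      rwa [BoundedContinuousFunction.coe_neg, Pi.neg_apply, sup_eq_left.2 (neg_nonneg.2 h)] at this

end DisjointSup

/-- Order bounded disjoint sequences of positive elements converge to zero. -/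
def IsPreLebesgue (X : Type*) [AddCommGroup X] [Lattice X] [TopologicalSpace X] : Prop :=
  ∀ (d : ℕ → X) (u : X), (∀ n, 0 ≤ d n) → (∀ n, d n ≤ u) → (∀ m n, m ≠ n → d m ⊓ d n = 0) →
    Tendsto d atTop (𝓝 0)

/-! ### The pre-Lebesgue property and monotone convergence -/

section PreLebesgue

variable {X : Type*} [AddCommGroup X] [Lattice X] [IsOrderedAddMonoid X]
    [Module ℝ X] [IsOrderedModule ℝ X]

theorem IsLatticeSeminormBasis.exists_subseq_le [TopologicalSpace X] {P : ℕ → Seminorm ℝ X}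
    (hP : IsLatticeSeminormBasis P) {x : ℕ → X} (hx : ¬ Tendsto x atTop (𝓝 0)) :
    ∃ n, ∃ ε > 0, ∃ φ : ℕ → ℕ, StrictMono φ ∧ ∀ k, ε ≤ P n (x (φ k)) := by
  rw [hP.tendsto_zero_iff] at hx
  push Not at hx
  obtain ⟨n, hn⟩ := hx
  by_contra! h
  refine hn (tendsto_order.2 ⟨fun a ha => Eventually.of_forall fun k =>
    ha.trans_le (apply_nonneg _ _), fun ε hε => ?_⟩)
  by_contra hfr
  obtain ⟨φ, hφ, hφ'⟩ := extraction_of_frequently_atTop (not_eventually.1 hfr)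
  obtain ⟨k, hk⟩ := h n ε hε φ hφ
  exact hφ' k hk

/-- Along a subsequence with `P n (d k) ≥ ε`, the bounds `|a k| • d k ≤ |T a| ≤ ‖a‖ • u` give `ε *
‖a‖ ≤ P n (T a)` and continuity, so `T` is an embedding. -/
theorem isPreLebesgue_of_not_containsLatticeCopyOfLInfty [TopologicalSpace X]
    [IsTopologicalAddGroup X] {P : ℕ → Seminorm ℝ X} (hP : IsLatticeSeminormBasis P)
    (hX : IsSigmaOrderComplete X) (hno : ¬ ContainsLatticeCopyOfLInfty X) : IsPreLebesgue X := by
  intro d u hd0 hdu hd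
  by_contra hlim
  obtain ⟨n, ε, hε, φ, hφ, hφε⟩ := hP.exists_subseq_le hlim
  obtain ⟨T, hsup, hinf, hTu, hTd⟩ := exists_lattice_hom_of_disjoint hX (d := d ∘ φ)
    (fun k => hd0 _) (fun k => hdu _) (fun i j hij => hd _ _ (hφ.injective.ne hij))
  have hbound : ∀ a, ‖a‖ ≤ ε⁻¹ * P n (T a) := fun a => by
    rw [BoundedContinuousFunction.norm_le (by positivity)]
    intro k
    rw [← div_eq_inv_mul, le_div_iff₀ hε, Real.norm_eq_abs]
    calc |a k| * ε ≤ |a k| * P n (d (φ k)) := by gcongr; exact hφε k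
      _ = P n (|a k| • d (φ k)) := by rw [map_smul_eq_mul, Real.norm_eq_abs, abs_abs]
      _ ≤ P n |T a| := hP.apply_le n (smul_nonneg (abs_nonneg _) (hd0 _)) (hTd a k)
      _ = P n (T a) := hP.apply_abs n _
  refine hno ⟨T, hsup, hinf, ?_, ?_⟩
  · rw [IsTopologicalAddGroup.isInducing_iff_nhds_zero]
    refine le_antisymm (tendsto_iff_comap.1 ?_) ?_
    · refine hP.tendsto_zero_iff.2 fun m => ?_
      have h1 : Tendsto (fun a : ℕ →ᵇ ℝ => ‖a‖ * P m u) (𝓝 0) (𝓝 (‖(0 : ℕ →ᵇ ℝ)‖ * P m u)) :=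
        (continuous_norm.mul continuous_const).tendsto 0
      rw [norm_zero, zero_mul] at h1
      refine squeeze_zero (fun _ => apply_nonneg _ _) (fun a => ?_) h1
      calc P m (T a) = P m |T a| := (hP.apply_abs m _).symm
        _ ≤ P m (‖a‖ • u) := hP.apply_le m (abs_nonneg _) (hTu a)
        _ = ‖a‖ * P m u := by rw [map_smul_eq_mul, norm_norm]
    · have h1 : Tendsto (fun a => ε⁻¹ * P n (T a)) (comap T (𝓝 0)) (𝓝 (ε⁻¹ * 0)) :=
        ((hP.tendsto_zero_iff.1 tendsto_comap n)).const_mul _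
      rw [mul_zero] at h1
      exact tendsto_zero_iff_norm_tendsto_zero.2
        (squeeze_zero (fun a => norm_nonneg a) hbound h1)
  · rw [injective_iff_map_eq_zero]
    intro a ha
    have := hbound a
    rw [ha, map_zero, mul_zero] at this
    exact norm_le_zero_iff.1 this

section Complete

variable [UniformSpace X] [IsUniformAddGroup X] [CompleteSpace X] [T1Space X]
    {P : ℕ → Seminorm ℝ X}

/-- Induction on `k`: the overlaps with a fixed member satisfy the hypothesis for one index fewer,
hence are null. A subsequence staying away from zero would then be nearly disjoint, against the
pre-Lebesgue property. -/
theorem IsPreLebesgue.tendsto_of_forall_card (hL : IsPreLebesgue X)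
    (hP : IsLatticeSeminormBasis P) (k : ℕ) {w : ℕ → X} {u : X} (hw0 : ∀ n, 0 ≤ w n)
    (hwu : ∀ n, w n ≤ u)
    (hw : ∀ s : Finset ℕ, s.card = k + 1 → ∀ z, (∀ i ∈ s, z ≤ w i) → z ≤ 0) :
    Tendsto w atTop (𝓝 0) := by
  induction k generalizing w u with
  | zero =>
    have : w = fun _ => 0 := funext fun i => le_antisymm
      (hw {i} (Finset.card_singleton i) _ (by simp)) (hw0 i)
    rw [this]
    exact tendsto_const_nhds
  | succ k ih =>
    by_contra hlim
    obtain ⟨n, ε, hε, φ, hφ, hφε⟩ := hP.exists_subseq_le hlim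
    have hinf : ∀ i, Tendsto (fun j => |w (φ i)| ⊓ |w (φ j)|) atTop (𝓝 0) := fun i => by
      simp only [abs_of_nonneg (hw0 _)]
      -- The shift keeps `φ i` out of the chosen indices, so adjoining it raises the cardinality.
      rw [← tendsto_add_atTop_iff_nat (i + 1)]
      refine ih (u := u) (fun j => le_inf (hw0 _) (hw0 _))
        (fun j => inf_le_left.trans (hwu _)) fun s hs z hz => ?_
      have hinj : Function.Injective fun j => φ (j + (i + 1)) :=
        hφ.injective.comp (add_left_injective _)
      have hi : φ i ∉ s.map ⟨_, hinj⟩ := by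
        simp only [Finset.mem_map, Function.Embedding.coeFn_mk, not_exists, not_and]
        intro j _ h
        have := hφ.injective h
        omega
      refine hw (Finset.cons (φ i) (s.map ⟨_, hinj⟩) hi)
        (by rw [Finset.card_cons, Finset.card_map, hs]) z fun j hj => ?_
      rcases Finset.mem_cons.1 hj with rfl | hj
      · obtain ⟨l, hl⟩ : s.Nonempty := Finset.card_pos.1 (by omega)
        exact (hz l hl).trans inf_le_left
      · obtain ⟨l, hl, rfl⟩ := Finset.mem_map.1 hj
        exact (hz l hl).trans inf_le_right
    obtain ⟨ψ, -, d, hd, hdw, hdlim⟩ := hP.exists_disjoint_approx (x := w ∘ φ) hinf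
    have hd_lim : Tendsto d atTop (𝓝 0) :=
      hP.tendsto_zero_of_le (hL (fun n => |d n|) u (fun n => abs_nonneg _)
        (fun n => (hdw n).trans (by
          rw [Function.comp, abs_of_nonneg (hw0 _)]; exact hwu _)) hd)
        fun i => (abs_abs _).ge
    have h := hdlim.add hd_lim
    simp only [sub_add_cancel, add_zero] at h
    exact absurd (ge_of_tendsto (hP.tendsto_zero_iff.1 h n)
      (Eventually.of_forall fun k => hφε (ψ k))) (not_le.2 hε)

/-- With `c = 1 / (k + 1)`, any `k + 1` of the `y i - c • u` have sum at most zero. Their positive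
parts are therefore null by the previous lemma, and `c • u` is small for large `k`. -/
theorem IsPreLebesgue.tendsto_of_sum_le (hL : IsPreLebesgue X) (hP : IsLatticeSeminormBasis P)
    {y : ℕ → X} {u : X} (hy0 : ∀ n, 0 ≤ y n) (hyu : ∀ N, ∑ i ∈ Finset.range N, y i ≤ u) :
    Tendsto y atTop (𝓝 0) := by
  have hu : 0 ≤ u := by simpa using hyu 0
  have hle : ∀ s : Finset ℕ, ∑ i ∈ s, y i ≤ u := fun s =>
    (Finset.sum_le_sum_of_subset_of_nonneg (t := Finset.range (s.sup id + 1)) (fun i hi =>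
      Finset.mem_range.2 (Nat.lt_succ_of_le (Finset.le_sup (f := id) hi)))
      fun i _ _ => hy0 i).trans (hyu _)
  refine hP.tendsto_zero_iff.2 fun n => tendsto_order.2
    ⟨fun a ha => Eventually.of_forall fun k => ha.trans_le (apply_nonneg _ _), fun ε hε => ?_⟩
  obtain ⟨k, hk⟩ := exists_nat_gt (P n u / (ε / 2))
  set c : ℝ := ((k + 1 : ℕ) : ℝ)⁻¹ with hc
  have hk1 : (0 : ℝ) < ((k + 1 : ℕ) : ℝ) := by positivity
  have hcu : P n (c • u) < ε / 2 := by
    rw [div_lt_iff₀ (by positivity)] at hk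
    rw [map_smul_eq_mul, Real.norm_of_nonneg (by positivity), hc, inv_mul_lt_iff₀ hk1]
    push_cast
    linarith
  have hlim : Tendsto (fun i => (y i - c • u)⁺) atTop (𝓝 0) := by
    have hcu0 : 0 ≤ c • u := smul_nonneg (by positivity) hu
    refine hL.tendsto_of_forall_card hP k (u := u) (fun i => posPart_nonneg _)
      (fun i => sup_le ((sub_le_self _ hcu0).trans (by simpa using hle {i})) hu)
      fun s hs z hz => nonpos_of_forall_le_posPart (Finset.card_pos.1 (by omega)) ?_ hz
    rw [Finset.sum_sub_distrib, Finset.sum_const, hs, ← Nat.cast_smul_eq_nsmul ℝ, smul_smul,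
      hc, mul_inv_cancel₀ hk1.ne', one_smul]
    exact sub_nonpos.2 (hle s)
  filter_upwards [(hP.tendsto_zero_iff.1 hlim n).eventually (gt_mem_nhds (half_pos hε))] with i hi
  calc P n (y i) ≤ P n ((y i - c • u)⁺ + c • u) :=
        hP.apply_le n (hy0 i) (sub_le_iff_le_add.1 (le_posPart _))
    _ ≤ P n ((y i - c • u)⁺) + P n (c • u) := map_add_le_add _ _ _
    _ < ε := by linarith

/-- Otherwise iterating the choice `f` gives increments of size at least `ε` whose sums telescope
below `u - s 0`. -/
theorem IsPreLebesgue.cauchySeq_of_monotone (hL : IsPreLebesgue X)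
    (hP : IsLatticeSeminormBasis P) {s : ℕ → X} {u : X} (hs : Monotone s) (hsu : ∀ n, s n ≤ u) :
    CauchySeq s := by
  refine hP.cauchySeq ?_
  by_contra! h
  obtain ⟨n, ε, hε, h⟩ := h
  choose f hf hfε using h
  let g : ℕ → ℕ := fun k => f^[k] 0
  have hg : ∀ k, g (k + 1) = f (g k) := fun k => Function.iterate_succ_apply' f k 0
  have hlim := hL.tendsto_of_sum_le hP (y := fun k => s (g (k + 1)) - s (g k)) (u := u - s 0)
    (fun k => sub_nonneg.2 (hs (by rw [hg]; exact hf _)))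
    (fun N => by rw [Finset.sum_range_sub (fun k => s (g k))]; exact sub_le_sub_right (hsu _) _)
  refine absurd (ge_of_tendsto (hP.tendsto_zero_iff.1 hlim n)
    (Eventually.of_forall fun k => ?_)) (not_le.2 hε)
  rw [hg]
  exact hfε _

theorem IsPreLebesgue.exists_tendsto_of_monotone (hL : IsPreLebesgue X)
    (hP : IsLatticeSeminormBasis P) {s : ℕ → X} {u : X} (hs : Monotone s) (hsu : ∀ n, s n ≤ u) :
    ∃ a, Tendsto s atTop (𝓝 a) :=
  cauchySeq_tendsto_of_complete (hL.cauchySeq_of_monotone hP hs hsu)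

theorem IsPreLebesgue.exists_tendsto_of_antitone (hL : IsPreLebesgue X)
    (hP : IsLatticeSeminormBasis P) {s : ℕ → X} {u : X} (hs : Antitone s) (hsu : ∀ n, u ≤ s n) :
    ∃ a, Tendsto s atTop (𝓝 a) := by
  obtain ⟨a, ha⟩ := hL.exists_tendsto_of_monotone hP (s := fun n => -s n) (u := -u)
    (fun m n h => neg_le_neg (hs h)) fun n => neg_le_neg (hsu n)
  exact ⟨-a, by simpa using ha.neg⟩

end Complete

end PreLebesgue

/-! ### Positive functionals and order bounded sequences -/

section PositiveFunctional

variable {X : Type*} [AddCommGroup X] [Lattice X] [IsOrderedAddMonoid X]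
    [Module ℝ X] [IsOrderedModule ℝ X]

theorem posPart_real_smul {c : ℝ} (hc : 0 ≤ c) (x : X) : (c • x)⁺ = c • x⁺ := by
  rcases hc.eq_or_lt with rfl | hc
  · simp
  · have h : c • (x ⊔ 0) = c • x ⊔ c • (0 : X) := (OrderIso.smulRight (β := X) hc).map_sup x 0
    rw [smul_zero] at h
    exact h.symm

/-- Hahn–Banach with the sublinear map `x ↦ p x⁺`, which vanishes on negative elements and so forces
the extension to be positive. -/
theorem exists_positiveDual_eq [TopologicalSpace X] [IsTopologicalAddGroup X] {p : Seminorm ℝ X}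
    (hpc : Continuous p) (hp : ∀ ⦃x y⦄, |x| ≤ |y| → p x ≤ p y) {y : X} (hy : 0 ≤ y) :
    ∃ f : PositiveDual X, f.1 y = p y ∧ ∀ x, 0 ≤ x → f.1 x ≤ p x := by
  rcases eq_or_ne y 0 with rfl | hy0
  · exact ⟨⟨0, fun _ _ => le_rfl⟩, by simp, fun x _ => by simp⟩
  have hle : ∀ x, p x⁺ ≤ p x := fun x => hp (by
    rw [abs_of_nonneg (posPart_nonneg x)]
    exact sup_le (le_abs_self x) (abs_nonneg x))
  obtain ⟨g, hg, hgN⟩ := exists_extension_of_le_sublinear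
    (LinearPMap.mkSpanSingleton y (p y) hy0) (fun x => p x⁺)
    (fun c hc x => by rw [posPart_real_smul hc.le, map_smul_eq_mul, Real.norm_of_nonneg hc.le])
    (fun a b => by
      refine (hp ?_).trans (map_add_le_add p a⁺ b⁺)
      rw [abs_of_nonneg (posPart_nonneg _),
        abs_of_nonneg (add_nonneg (posPart_nonneg a) (posPart_nonneg b))]
      exact sup_le (add_le_add (le_posPart a) (le_posPart b))
        (add_nonneg (posPart_nonneg a) (posPart_nonneg b)))
    (by
      rintro ⟨x, hx⟩
      obtain ⟨c, rfl⟩ := Submodule.mem_span_singleton.1 hx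
      rw [LinearPMap.mkSpanSingleton'_apply, RingHom.id_apply, smul_eq_mul]
      rcases le_total 0 c with hc | hc
      · rw [posPart_real_smul hc, posPart_eq_self.2 hy, map_smul_eq_mul, Real.norm_of_nonneg hc]
      · exact (mul_nonpos_of_nonpos_of_nonneg hc (apply_nonneg _ _)).trans (apply_nonneg _ _))
  have habs : ∀ x, ‖g x‖ ≤ p x := fun x => by
    rw [Real.norm_eq_abs, abs_le']
    refine ⟨(hgN x).trans (hle x), ?_⟩
    rw [← map_neg, ← map_neg_eq_map p]
    exact (hgN _).trans (hle _)
  have hgc : Continuous g := by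
    refine continuous_of_continuousAt_zero g ?_
    rw [ContinuousAt, map_zero]
    have h0 := hpc.tendsto 0
    rw [map_zero] at h0
    exact squeeze_zero_norm habs h0
  refine ⟨⟨⟨g, hgc⟩, fun x hx => ?_⟩, ?_, fun x hx => (le_abs_self _).trans (habs x)⟩
  · have := hgN (-x)
    rw [posPart_eq_zero.2 (neg_nonpos.2 hx), map_zero, map_neg] at this
    exact neg_nonpos.1 this
  · have := hg ⟨y, Submodule.mem_span_singleton_self y⟩
    exact this.trans (LinearPMap.mkSpanSingleton'_apply_self y (p y) _ _)

theorem PositiveDual.mono [TopologicalSpace X] (f : PositiveDual X) {x y : X} (h : x ≤ y) :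
    f.1 x ≤ f.1 y := by
  have := f.2 _ (sub_nonneg.2 h)
  rw [map_sub] at this
  exact sub_nonneg.1 this

/-- Under the pre-Lebesgue property, order bounded weakly null sequences of positive elements are
null. -/
theorem IsPreLebesgue.tendsto_of_forall_positiveDual [UniformSpace X] [IsUniformAddGroup X]
    [CompleteSpace X] [T1Space X] {P : ℕ → Seminorm ℝ X} (hL : IsPreLebesgue X)
    (hP : IsLatticeSeminormBasis P) {y : ℕ → X} {u : X} (hy0 : ∀ n, 0 ≤ y n) (hyu : ∀ n, y n ≤ u)
    (hy : ∀ f : PositiveDual X, Tendsto (fun n => f.1 (y n)) atTop (𝓝 0)) :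
    Tendsto y atTop (𝓝 0) := by
  by_contra hlim
  obtain ⟨N, ε, hε, φ, hφ, hφε⟩ := hP.exists_subseq_le hlim
  -- `f k` norms the `k`-th term; the further subsequence `z` makes each `f i` summable along its
  -- tail.
  choose f hfy hfp using fun k => exists_positiveDual_eq (hP.cont N) (hP.solid N) (hy0 (φ k))
  obtain ⟨ψ, hψ, hψf⟩ := extraction_forall_of_eventually
    (P := fun n k => ∀ i ∈ Finset.range (n + 1), (f i).1 (y (φ k)) ≤ (1 / 2 : ℝ) ^ n)
    (fun n => (Finset.eventually_all _).2 fun i _ =>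
      ((hy (f i)).comp hφ.tendsto_atTop).eventually_le_const (by positivity))
  set z : ℕ → X := fun n => y (φ (ψ n)) with hz
  have hz0 : ∀ n, 0 ≤ z n := fun n => hy0 _
  have hfz : ∀ i n, i ≤ n → (f i).1 (z n) ≤ (1 / 2 : ℝ) ^ n := fun i n hin =>
    hψf n i (Finset.mem_range.2 (by omega))
  -- The tail suprema `t k` exist as limits and decrease to some `b`.
  let s : ℕ → ℕ → X := fun k => partialSups fun j => z (k + j)
  have hsu : ∀ k m, s k m ≤ u := fun k m => partialSups_le _ _ _ fun j _ => hyu _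
  choose t ht using fun k => hL.exists_tendsto_of_monotone hP (s := s k)
    (partialSups_monotone _) (hsu k)
  have hst : ∀ k m, s k m ≤ t k := fun k m => hP.ge_of_tendsto' (ht k)
    ((eventually_ge_atTop m).mono fun l hl => partialSups_monotone _ hl)
  have hzt : ∀ k, z k ≤ t k := fun k =>
    (le_partialSups_of_le (fun j => z (k + j)) le_rfl : z (k + 0) ≤ s k 0).trans (hst k 0)
  have htanti : Antitone t := antitone_nat_of_succ_le fun k => by
    refine hP.le_of_tendsto' (ht (k + 1)) (Eventually.of_forall fun m => ?_)
    refine (partialSups_le _ _ _ fun j hj => ?_).trans (hst k (m + 1))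
    rw [show k + 1 + j = k + (j + 1) by ring]
    exact le_partialSups_of_le (fun j => z (k + j)) (Nat.succ_le_succ hj)
  obtain ⟨b, hb⟩ := hL.exists_tendsto_of_antitone hP htanti fun k => (hz0 k).trans (hzt k)
  have hbt : ∀ k, b ≤ t k := fun k => hP.le_of_tendsto' hb
    ((eventually_ge_atTop k).mono fun l hl => htanti hl)
  have hft : ∀ i k, i ≤ k → (f i).1 (t k) ≤ 2 * (1 / 2 : ℝ) ^ k := fun i k hik => by
    refine le_of_tendsto (((f i).1.continuous.tendsto _).comp (ht k))
      (Eventually.of_forall fun m => ?_)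
    calc (f i).1 (s k m) ≤ (f i).1 (∑ j ∈ Finset.range (m + 1), z (k + j)) :=
          (f i).mono (partialSups_le _ _ _ fun j hj => Finset.single_le_sum
            (f := fun j => z (k + j)) (fun j _ => hz0 _) (Finset.mem_range.2 (by omega)))
      _ = ∑ j ∈ Finset.range (m + 1), (f i).1 (z (k + j)) := map_sum _ _ _
      _ ≤ ∑ j ∈ Finset.range (m + 1), (1 / 2 : ℝ) ^ j * (1 / 2) ^ k :=
          Finset.sum_le_sum fun j _ => by
            rw [← pow_add, add_comm j]
            exact hfz i (k + j) (by omega)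
      _ = (∑ j ∈ Finset.range (m + 1), (1 / 2 : ℝ) ^ j) * (1 / 2) ^ k := by rw [Finset.sum_mul]
      _ ≤ 2 * (1 / 2 : ℝ) ^ k := by
          gcongr
          exact sum_geometric_two_le _
  -- No `f i` is positive at `b`, so `f (ψ k)` sees at least `ε` of `t k - b`, although `t k - b` is
  -- null.
  have hfb : ∀ i, (f i).1 b ≤ 0 := fun i => by
    have h0 : Tendsto (fun k : ℕ => 2 * (1 / 2 : ℝ) ^ k) atTop (𝓝 (2 * 0)) :=
      (tendsto_pow_atTop_nhds_zero_of_lt_one (by norm_num) (by norm_num)).const_mul 2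
    rw [mul_zero] at h0
    exact ge_of_tendsto h0 ((eventually_ge_atTop i).mono fun k hk =>
      ((f i).mono (hbt k)).trans (hft i k hk))
  have hlim0 : Tendsto (fun k => t k - b) atTop (𝓝 0) := by simpa using hb.sub_const b
  refine absurd (ge_of_tendsto (hP.tendsto_zero_iff.1 hlim0 N)
    (Eventually.of_forall fun k => ?_)) (not_le.2 hε)
  calc ε ≤ (f (ψ k)).1 (z k) := by rw [hfy]; exact hφε _
    _ ≤ (f (ψ k)).1 (t k) := (f _).mono (hzt k)
    _ = (f (ψ k)).1 (t k - b) + (f (ψ k)).1 b := by rw [map_sub, sub_add_cancel]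
    _ ≤ P N (t k - b) + 0 := add_le_add (hfp _ _ (sub_nonneg.2 (hbt k))) (hfb _)
    _ = P N (t k - b) := add_zero _

end PositiveFunctional

/-! ### A Schreier-type sequence in `ℓ∞` -/

section Schreier

/-- A finite set of natural numbers is admissible if its cardinality is at most each of its
members. -/
def IsAdmissible (A : Finset ℕ) : Prop := ∀ a ∈ A, A.card ≤ a

/-- The coordinate functions on the countable set of all admissible sets, which is indexed by
the natural numbers via the enumeration of all finite sets. -/
noncomputable def schreierSeq (n : ℕ) : ℕ →ᵇ ℝ :=
  open Classical in
  BoundedContinuousFunction.ofNormedAddCommGroupDiscrete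
    (fun m => if IsAdmissible ((Denumerable.eqv (Finset ℕ)).symm m) ∧
      n ∈ (Denumerable.eqv (Finset ℕ)).symm m then 1 else 0) 1
    (fun m => by split_ifs <;> simp)

open Classical in
theorem schreierSeq_apply (n m : ℕ) : schreierSeq n m =
    if IsAdmissible ((Denumerable.eqv (Finset ℕ)).symm m) ∧
      n ∈ (Denumerable.eqv (Finset ℕ)).symm m then 1 else 0 := rfl

theorem schreierSeq_nonneg (n : ℕ) : 0 ≤ schreierSeq n := fun m => by
  classical
  change (0 : ℝ) ≤ schreierSeq n m
  rw [schreierSeq_apply]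
  split_ifs <;> norm_num

theorem schreierSeq_le_one (n : ℕ) : schreierSeq n ≤ 1 := fun m => by
  classical
  change schreierSeq n m ≤ 1
  rw [schreierSeq_apply]
  split_ifs <;> norm_num

theorem norm_schreierSeq_le (n : ℕ) : ‖schreierSeq n‖ ≤ 1 := by
  rw [BoundedContinuousFunction.norm_le zero_le_one]
  intro m
  exact (Real.norm_of_nonneg (schreierSeq_nonneg n m)).trans_le (schreierSeq_le_one n m)

/-- Only coordinates `A` admissible with `n ∈ A` contribute, and there the sum counts at most `|A| ≤
n` indices. -/
theorem sum_schreierSeq_inf_le (n N : ℕ) :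
    ∑ k ∈ Finset.range N, schreierSeq n ⊓ schreierSeq k ≤ (n : ℝ) • (1 : ℕ →ᵇ ℝ) := fun m => by
  classical
  change (∑ k ∈ Finset.range N, schreierSeq n ⊓ schreierSeq k) m ≤ (n : ℝ) * 1
  rw [BoundedContinuousFunction.coe_sum, Finset.sum_apply, mul_one]
  simp only [BoundedContinuousFunction.coe_inf, Pi.inf_apply, schreierSeq_apply]
  by_cases h : IsAdmissible ((Denumerable.eqv (Finset ℕ)).symm m) ∧ n ∈ (Denumerable.eqv (Finset ℕ)).symm m
  · calc _ ≤ ∑ k ∈ Finset.range N, if k ∈ (Denumerable.eqv (Finset ℕ)).symm m then (1 : ℝ) else 0 :=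
          Finset.sum_le_sum fun k _ => inf_le_right.trans (by simp [h.1])
      _ ≤ (((Denumerable.eqv (Finset ℕ)).symm m).card : ℝ) := by
          rw [Finset.sum_boole]
          exact_mod_cast Finset.card_le_card fun k hk => (Finset.mem_filter.1 hk).2
      _ ≤ n := by exact_mod_cast h.1 n h.2
  · rw [if_neg h]
    exact (Finset.sum_nonpos fun k _ => inf_le_left).trans (Nat.cast_nonneg n)

/-- If `g` were at least `ε` infinitely often, suprema of `M` terms with small overlaps would have
`g`-value at least `M * (ε / 2)` while staying below `1`. -/
theorem tendsto_map_schreierSeq {g : (ℕ →ᵇ ℝ) →ₗ[ℝ] ℝ} (hg : ∀ a, 0 ≤ a → 0 ≤ g a) :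
    Tendsto (fun n => g (schreierSeq n)) atTop (𝓝 0) := by
  have hmono : ∀ a b, a ≤ b → g a ≤ g b := fun a b hab => by
    have := hg _ (sub_nonneg.2 hab)
    rw [map_sub] at this
    exact sub_nonneg.1 this
  have hinf : ∀ n, Tendsto (fun k => g (schreierSeq n ⊓ schreierSeq k)) atTop (𝓝 0) := fun n => by
    refine (summable_of_sum_range_le (c := g ((n : ℝ) • 1)) (fun k => hg _
      (le_inf (schreierSeq_nonneg n) (schreierSeq_nonneg k))) fun N => ?_).tendsto_atTop_zero
    rw [← map_sum]
    exact hmono _ _ (sum_schreierSeq_inf_le n N)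
  refine tendsto_order.2 ⟨fun a ha => Eventually.of_forall fun k =>
    ha.trans_le (hg _ (schreierSeq_nonneg k)), fun ε hε => ?_⟩
  by_contra hfr
  rw [not_eventually] at hfr
  have key : ∀ M : ℕ, ∃ y : ℕ →ᵇ ℝ, 0 ≤ y ∧ y ≤ 1 ∧
      Tendsto (fun k => g (y ⊓ schreierSeq k)) atTop (𝓝 0) ∧ M * (ε / 2) ≤ g y := by
    intro M
    induction M with
    | zero =>
      refine ⟨0, le_rfl, fun m => zero_le_one, ?_, by simp⟩
      simp only [inf_eq_left.2 (schreierSeq_nonneg _), map_zero]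
      exact tendsto_const_nhds
    | succ M ih =>
      obtain ⟨y, hy0, hy1, hylim, hyM⟩ := ih
      obtain ⟨n, hn, hyn⟩ :=
        (hfr.and_eventually (hylim.eventually (gt_mem_nhds (half_pos hε)))).exists
      refine ⟨y ⊔ schreierSeq n, hy0.trans le_sup_left, sup_le hy1 (schreierSeq_le_one n), ?_, ?_⟩
      · have h0 := hylim.add (hinf n)
        rw [add_zero] at h0
        refine squeeze_zero (fun k => hg _ (le_inf (hy0.trans le_sup_left)
          (schreierSeq_nonneg k))) (fun k => ?_) h0
        rw [← map_add]
        refine hmono _ _ (le_trans ?_ (inf_add_le hy0 (schreierSeq_nonneg n)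
          (schreierSeq_nonneg k)))
        exact inf_le_inf_right _ (sup_le (le_add_of_nonneg_right (schreierSeq_nonneg n))
          (le_add_of_nonneg_left hy0))
      -- `g (y ⊔ e) = g y + g e - g (y ⊓ e)`, which gains at least `ε - ε / 2`.
      · have e := congrArg g (inf_add_sup y (schreierSeq n))
        rw [map_add, map_add] at e
        push_cast
        linarith [not_lt.1 hn]
  obtain ⟨M, hM⟩ := exists_nat_gt (g 1 / (ε / 2))
  obtain ⟨y, -, hy1, -, hyM⟩ := key M
  rw [div_lt_iff₀ (half_pos hε)] at hM
  linarith [hmono _ _ hy1]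

/-- The set `A = {φ L, …, φ (2L - 1)}` is admissible since `φ k ≥ k ≥ L = |A|`. At this coordinate
the `L`-th mean is `0` and the `2L`-th is `1/2`. -/
theorem not_cauchySeq_cesaro_schreierSeq {φ : ℕ → ℕ} (hφ : StrictMono φ) :
    ¬ CauchySeq fun n : ℕ => (n : ℝ)⁻¹ • ∑ k ∈ Finset.range n, schreierSeq (φ k) := by
  classical
  intro h
  obtain ⟨N, hN⟩ := Metric.cauchySeq_iff.1 h (1 / 2) (by norm_num)
  -- `N + 1` rather than `N`, so that `L` is nonzero.
  set L := N + 1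
  have h1 := hN (2 * L) (by omega) L (by omega)
  set A : Finset ℕ := (Finset.Ico L (2 * L)).map ⟨φ, hφ.injective⟩ with hA
  have hAcard : A.card = L := by rw [hA, Finset.card_map, Nat.card_Ico]; omega
  have hAadm : IsAdmissible A := fun a ha => by
    obtain ⟨k, hk, rfl⟩ := Finset.mem_map.1 ha
    rw [hAcard]
    exact (Finset.mem_Ico.1 hk).1.trans (hφ.id_le k)
  have hmem : ∀ k, φ k ∈ A ↔ k ∈ Finset.Ico L (2 * L) := fun k =>
    Finset.mem_map' (⟨φ, hφ.injective⟩ : ℕ ↪ ℕ)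
  have hval : ∀ k, schreierSeq (φ k) (Denumerable.eqv (Finset ℕ) A) =
      if k ∈ Finset.Ico L (2 * L) then 1 else 0 := fun k => by
    rw [schreierSeq_apply, Equiv.symm_apply_apply]
    simp only [hAadm, true_and, hmem]
  have hsum : ∀ n : ℕ, ((n : ℝ)⁻¹ • ∑ k ∈ Finset.range n, schreierSeq (φ k)) (Denumerable.eqv (Finset ℕ) A) =
      (n : ℝ)⁻¹ * ∑ k ∈ Finset.range n, if k ∈ Finset.Ico L (2 * L) then (1 : ℝ) else 0 :=
    fun n => by
      simp only [BoundedContinuousFunction.coe_smul, BoundedContinuousFunction.coe_sum,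
        Finset.sum_apply, smul_eq_mul, hval]
  have h2 := (BoundedContinuousFunction.dist_coe_le_dist (Denumerable.eqv (Finset ℕ) A)).trans_lt h1
  rw [hsum, hsum, Finset.sum_boole, Finset.sum_boole] at h2
  have e1 : (Finset.range (2 * L)).filter (· ∈ Finset.Ico L (2 * L)) = Finset.Ico L (2 * L) := by
    ext k; simp
  have e2 : (Finset.range L).filter (· ∈ Finset.Ico L (2 * L)) = ∅ := by
    ext k; simp; omega
  rw [e1, e2, Nat.card_Ico, Finset.card_empty, Real.dist_eq] at h2
  have hL : (L : ℝ) ≠ 0 := by positivity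
  rw [show 2 * L - L = L by omega] at h2
  push_cast at h2
  rw [mul_zero, sub_zero, mul_inv, mul_assoc, inv_mul_cancel₀ hL, mul_one,
    abs_of_pos (by norm_num)] at h2
  norm_num at h2

end Schreier

/-! ### The two implications -/

section Main

variable {X : Type*} [AddCommGroup X] [Lattice X] [IsOrderedAddMonoid X]
    [Module ℝ X] [IsOrderedModule ℝ X]

theorem isUnboundedNull_absoluteWeakTopology_iff [TopologicalSpace X] {x : ℕ → X} :
    IsUnboundedNull (absoluteWeakTopology X) x ↔
      ∀ u, 0 ≤ u → ∀ f : PositiveDual X, Tendsto (fun n => f.1 (|x n| ⊓ u)) atTop (𝓝 0) := by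
  have hw : @WithSeminorms ℝ X _ _ _ _ (absoluteWeakSeminorms X) (absoluteWeakTopology X) :=
    @WithSeminorms.mk ℝ X _ _ _ _ (absoluteWeakSeminorms X) (absoluteWeakTopology X) rfl
  refine forall₂_congr fun u hu => ?_
  refine (@WithSeminorms.tendsto_nhds ℝ X ℕ _ _ _ _ (absoluteWeakTopology X) _ hw _ _ _).trans ?_
  refine forall_congr' fun f => ?_
  have hf : ∀ n, absoluteWeakSeminorms X f (|x n| ⊓ u - 0) = f.1 (|x n| ⊓ u) := fun n => by
    rw [sub_zero]
    change f.1 |(|x n| ⊓ u)| = _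
    rw [abs_of_nonneg (le_inf (abs_nonneg _) hu)]
  simp only [hf]
  refine ⟨fun h => tendsto_order.2 ⟨fun a ha => Eventually.of_forall fun n =>
    ha.trans_le (f.2 _ (le_inf (abs_nonneg _) hu)), h⟩, fun h => (tendsto_order.1 h).2⟩

theorem isVonNBounded_range_of_abs_le [TopologicalSpace X] [IsLocallySolid X] {x d : ℕ → X}
    {φ : ℕ → ℕ} (hx : Bornology.IsVonNBounded ℝ (Set.range x)) (hd : ∀ k, |d k| ≤ |x (φ k)|) :
    Bornology.IsVonNBounded ℝ (Set.range d) := by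
  rw [IsLocallySolid.hasBasis_nhds_zero.isVonNBounded_iff]
  rintro V ⟨hV, hVs⟩
  have h := hx hV
  rw [absorbs_iff_eventually_cobounded_mapsTo] at h ⊢
  filter_upwards [h] with c hc
  rintro _ ⟨k, rfl⟩
  refine hVs (hc ⟨φ k, rfl⟩) ?_
  rw [abs_real_smul_of_vectorLattice, abs_real_smul_of_vectorLattice]
  exact smul_le_smul_of_nonneg_left (hd k) (abs_nonneg _)

theorem IsLatticeSeminormBasis.tendsto_cesaro [TopologicalSpace X] {P : ℕ → Seminorm ℝ X}
    (hP : IsLatticeSeminormBasis P) {x : ℕ → X} (hx : Tendsto x atTop (𝓝 0)) :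
    Tendsto (fun n : ℕ => (n : ℝ)⁻¹ • ∑ k ∈ Finset.range n, x k) atTop (𝓝 0) := by
  refine hP.tendsto_zero_iff.2 fun m => squeeze_zero (fun _ => apply_nonneg _ _) (fun n => ?_)
    (hP.tendsto_zero_iff.1 hx m).cesaro
  rw [map_smul_eq_mul, Real.norm_of_nonneg (by positivity)]
  gcongr
  exact Seminorm.apply_sum_le _ _ _

/-- For `f ≥ 0` in the dual, `f ∘ T` is positive and `|T e_n| ⊓ u ≤ T e_n`, so the image of the
Schreier-type sequence is unbounded null. The embedding reflects Cauchy sequences. -/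
theorem ContainsLatticeCopyOfLInfty.not_lsubsp [UniformSpace X] [IsUniformAddGroup X]
    (h : ContainsLatticeCopyOfLInfty X) : ¬ LSUBSP X := by
  obtain ⟨T, hsup, -, hT⟩ := h
  intro hub
  have hTpos : ∀ a, 0 ≤ a → 0 ≤ T a := fun a ha => by
    rw [← sup_eq_left.2 ha, hsup, map_zero]
    exact le_sup_right
  let T' : (ℕ →ᵇ ℝ) →L[ℝ] X := ⟨T, hT.continuous⟩
  have hbdd : Bornology.IsVonNBounded ℝ (Set.range fun n => T (schreierSeq n)) := by
    have h1 : Bornology.IsVonNBounded ℝ (Set.range schreierSeq) :=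
      (NormedSpace.isVonNBounded_iff ℝ).2 (isBounded_iff_forall_norm_le.2
        ⟨1, by rintro _ ⟨n, rfl⟩; exact norm_schreierSeq_le n⟩)
    have h2 := h1.image T'
    rwa [← Set.range_comp] at h2
  obtain ⟨φ, hφ, a, ha⟩ := hub (fun n => T (schreierSeq n)) hbdd
    (isUnboundedNull_absoluteWeakTopology_iff.2 fun u hu f => by
      refine squeeze_zero (fun n => f.2 _ (le_inf (abs_nonneg _) hu)) (fun n => ?_)
        (tendsto_map_schreierSeq (g := f.1.toLinearMap ∘ₗ T) fun b hb => f.2 _ (hTpos b hb))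
      refine f.mono (inf_le_left.trans ?_)
      rw [abs_of_nonneg (hTpos _ (schreierSeq_nonneg n))])
  refine not_cauchySeq_cesaro_schreierSeq hφ
    ((AddMonoidHom.isUniformInducing_of_isInducing hT.isInducing).cauchy_map_iff.1 ?_)
  have := ha.cauchySeq
  simp only [← map_sum, ← map_smul] at this
  exact this

/-- Taking `u = |x i|` in the unbounded convergence makes the overlaps order bounded and null under
positive functionals, hence null. The perturbation does not affect Cesàro limits. -/
theorem LSDBSP.lsubsp [UniformSpace X] [IsUniformAddGroup X] [ContinuousSMul ℝ X]
    [IsLocallySolid X] [CompleteSpace X] [T1Space X] {P : ℕ → Seminorm ℝ X}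
    (hP : IsLatticeSeminormBasis P) (hL : IsPreLebesgue X) (h : LSDBSP X) : LSUBSP X := by
  intro x hx hnull
  rw [isUnboundedNull_absoluteWeakTopology_iff] at hnull
  obtain ⟨φ, hφ, d, hd, hdx, hlim⟩ := hP.exists_disjoint_approx (x := x) fun i => by
    simp only [inf_comm |x i|]
    exact hL.tendsto_of_forall_positiveDual hP (fun n => le_inf (abs_nonneg _) (abs_nonneg _))
      (fun n => inf_le_right) (hnull _ (abs_nonneg _))
  obtain ⟨ψ, hψ, a, ha⟩ := h d (isVonNBounded_range_of_abs_le hx hdx) hd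
  refine ⟨φ ∘ ψ, hφ.comp hψ, a, ?_⟩
  have := (hP.tendsto_cesaro (hlim.comp hψ.tendsto_atTop)).add ha
  simpa [Finset.sum_sub_distrib, smul_sub] using this

end Main

theorem theorem2p5 (X : Type*) [AddCommGroup X] [Lattice X] [IsOrderedAddMonoid X]
    [Module ℝ X] [IsOrderedModule ℝ X]
    [UniformSpace X] [IsUniformAddGroup X] [ContinuousSMul ℝ X]
    [IsLocallySolid X] [LocallyConvexSpace ℝ X]
    [TopologicalSpace.MetrizableSpace X] [CompleteSpace X]
    (hX : IsSigmaOrderComplete X) :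
    (LSDBSP X → (LSUBSP X ↔ ¬ ContainsLatticeCopyOfLInfty X)) ∧
      (ContainsLatticeCopyOfLInfty X → ¬ LSUBSP X) := by
  obtain ⟨P, hP⟩ := exists_isLatticeSeminormBasis (X := X)
  exact ⟨fun h => ⟨fun hu hc => hc.not_lsubsp hu, fun hno =>
    h.lsubsp hP (isPreLebesgue_of_not_containsLatticeCopyOfLInfty hP hX hno)⟩,
    fun hc => hc.not_lsubsp⟩
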